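/- Let $G$ be a probability distribution on $\mathbb{Z}_+=\{0,1,2,\dots\}$ that is not a point mass. For $\theta\in[0,1]$, let $\mathbb{P}_\theta$ be a probability measure under which $(\varepsilon_t)_{t\ge1}$ are i.i.d. with law $G$, $(Z^{(t)}_j)_{j,t\ge1}$ are i.i.d. Bernoulli variables with success probability $\theta$, and the two families are independent. Let $X$ be the INAR(1) process started at $0$, that is, $X_0=0$ and $$X_t=\sum_{j=1}^{X_{t-1}}Z^{(t)}_j+\varepsilon_t,\qquad t\ge1 .$$ Write $\mu_G=\mathbb{E}\,\varepsilon_1$ and consider the OLS estimators $$\hat\theta^{\rm OLS}_n=\frac{\sum_{t=1}^nX_{t-1}(X_t-\mu_G)}{\sum_{t=1}^nX_{t-1}^2},\qquad \hat h^{\rm OLS}_n=n^2\bigl(1-\hat\theta^{\rm OLS}_n\bigr),$$ which are defined on the event $\sum_{t=1}^nX_{t-1}^2\neq0$. **Proposition 4.3.** If $\mathbb{E}\,\varepsilon_1^3<\infty$, then for every $h\ge0$ we have $|\hat h^{\rm OLS}_n|\to\infty$ in probability under $\mathbb{P}_{1-h/n^2}$; that is, for every $M\in\mathbb{R}$, $$\lim_{n\to\infty}\mathbb{P}_{1-h/n^2}\Bigl(\textstyle\sum_{t=1}^nX_{t-1}^2\neq0\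 \text{ and }\ |\hat h^{\rm OLS}_n|>M\Bigr)=1 .$$ (Here $1-h/n^2\in[0,1]$ for all $n\ge\sqrt h$, and only these $n$ matter.) -/

import Mathlib

open MeasureTheory ProbabilityTheory Filter
open scoped Topology unitInterval

noncomputable section

namespace INAR

/-- The sample space of the primitive random variables. For `ω = (e, z)`, the coordinate `e t` is
the innovation `ε_{t+1}`, and the coordinate `z (t, j)` is the survival indicator `Z_{j+1}^{(t+1)}`
(both families are indexed from `1` in the usual notation, from `0` here). -/
abbrev Sample : Type := (ℕ → ℕ) × (ℕ × ℕ → ℕ)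

/-- The probability measure `P_{θ,G}`: the innovations are i.i.d. with law `G`, the survival
indicators are i.i.d. Bernoulli with success probability `θ` (values `1` and `0`), and the two
families are independent. -/
def prob (θ : I) (G : Measure ℕ) [IsProbabilityMeasure G] : Measure Sample :=
  (Measure.infinitePi fun _ : ℕ => G).prod
    (Measure.infinitePi fun _ : ℕ × ℕ => bernoulliMeasure (1 : ℕ) 0 θ)

instance (θ : I) (G : Measure ℕ) [IsProbabilityMeasure G] : IsProbabilityMeasure (prob θ G) := by
  unfold prob
  infer_instance

/-- The INAR(1) process started at `0`: `X_0 = 0` and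
`X_{t+1} = ∑_{j = 1}^{X_t} Z_j^{(t+1)} + ε_{t+1}`. -/
def X (ω : Sample) : ℕ → ℕ
  | 0 => 0
  | t + 1 => (∑ j ∈ Finset.range (X ω t), ω.2 (t, j)) + ω.1 t

/-- The mean `μ_G` of the immigration distribution `G`. -/
def mean (G : Measure ℕ) : ℝ := ∫ k, (k : ℝ) ∂G

/-- The denominator `∑_{t=1}^n X_{t-1}^2` of the OLS estimator. -/
def olsDenom (n : ℕ) (ω : Sample) : ℝ := ∑ t ∈ Finset.range n, (X ω t : ℝ) ^ 2

/-- The OLS estimator of the autoregression parameter (for known `G`),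
`∑_{t=1}^n X_{t-1} (X_t - μ_G) / ∑_{t=1}^n X_{t-1}^2`; meaningful where the denominator is
non-zero. -/
def thetaOLS (G : Measure ℕ) (n : ℕ) (ω : Sample) : ℝ :=
  (∑ t ∈ Finset.range n, (X ω t : ℝ) * ((X ω (t + 1) : ℝ) - mean G)) / olsDenom n ω

/-- The OLS estimator `n² (1 - θ̂_n)` of the local parameter `h`. -/
def hOLS (G : Measure ℕ) (n : ℕ) (ω : Sample) : ℝ :=
  (n : ℝ) ^ 2 * (1 - thetaOLS G n ω)

/-- The autoregression parameter `1 - h / n²`. For `h ≥ 0` this lies in `[0, 1]` as soon as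
`h ≤ n²`; for the finitely many other `n` it is replaced by the nearest point of `[0, 1]`, which
plays no role in a limit `n → ∞`. -/
def localTheta (h : ℝ) (n : ℕ) : I := Set.projIcc 0 1 zero_le_one (1 - h / (n : ℝ) ^ 2)

theorem coe_localTheta {h : ℝ} (hh : 0 ≤ h) {n : ℕ} (hn : h ≤ (n : ℝ) ^ 2) :
    (localTheta h n : ℝ) = 1 - h / (n : ℝ) ^ 2 := by
  have h1 : h / (n : ℝ) ^ 2 ≤ 1 := div_le_one_of_le₀ hn (by positivity)
  have h2 : 0 ≤ h / (n : ℝ) ^ 2 := by positivity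
  rw [localTheta, Set.projIcc_of_mem zero_le_one ⟨by linarith, by linarith⟩]

end INAR

end

noncomputable section

namespace INAR

/-! Write `S t` for the sum of the first `t` innovations and `m` for their mean. Then `ĥ = n² N / D`
with `N = ∑ X_t (X_t - X_{t+1} + m)` and `D = ∑ X_t² ≤ n (S n)²`, so `D` is at most of order `n³`,
and `|ĥ| ≤ M` forces `N` to be at most of order `n`. When `1 - θ = h / n²`, the expected number of
deaths up to time `n` is at most `h m`, so `X` differs from the random walk `S` by a tight amount.
Replacing `X` by `S` in `N` costs order `n`, and a discrete Itô expansion turns `∑ S_t (e_t - m)`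
into `m ∑ t (e_t - m)` plus another term of order `n`. Hence bounded `ĥ` would confine `∑ (t / n)
(e_t - m)` to a bounded interval, although its natural scale is `√n`. The contradiction needs only
anti-concentration, not a limit theorem: the characteristic function of the weighted sum tends to
zero away from the origin (`tendsto_measureReal_weightedSum`). The path argument is
`mul_abs_linearForm_le`; the deaths are controlled by `lintegral_failures_le`. -/

/-! ### Anti-concentration through characteristic functions -/

/-- The law of an innovation as a measure on the reals. -/
def realLaw (G : Measure ℕ) : Measure ℝ := G.map (fun k : ℕ => (k : ℝ))

instance (G : Measure ℕ) [IsProbabilityMeasure G] : IsProbabilityMeasure (realLaw G) :=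
  Measure.isProbabilityMeasure_map (by fun_prop)

theorem charFun_stdGaussianReal (t : ℝ) :
    charFun (gaussianReal 0 1) t = (Real.exp (-(t ^ 2 / 2)) : ℂ) := by
  rw [charFun_gaussianReal]
  push_cast
  simp

/-- An Esseen-type inequality with a Gaussian kernel. -/
theorem measureReal_abs_sub_le_integral_norm_charFun (ν : Measure ℝ) [IsProbabilityMeasure ν]
    (c : ℝ) {C : ℝ} (hC : 0 < C) :
    ν.real {y | |y - c| ≤ C} ≤
      Real.exp (1 / 2) * ∫ v, ‖charFun ν (v / C)‖ ∂(gaussianReal 0 1) := by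
  have hint : Integrable (fun y => Real.exp (-(((y - c) / C) ^ 2 / 2))) ν := by
    refine Integrable.of_bound (C := 1) (by fun_prop) (ae_of_all _ fun y => ?_)
    rw [Real.norm_eq_abs, Real.abs_exp]
    exact Real.exp_le_one_iff.2 (by have := sq_nonneg ((y - c) / C); linarith)
  have hmeas : MeasurableSet {y : ℝ | |y - c| ≤ C} := measurableSet_le (by fun_prop) (by fun_prop)
  -- The factor `exp (1/2)` is the least that lifts `exp (-x²/2)` above the indicator of `|x| ≤ 1`.
  have h1 : ν.real {y | |y - c| ≤ C} ≤
      Real.exp (1 / 2) * ∫ y, Real.exp (-(((y - c) / C) ^ 2 / 2)) ∂ν := by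
    rw [← integral_const_mul, ← integral_indicator_one hmeas]
    refine integral_mono ((integrable_const 1).indicator hmeas) (hint.const_mul _) fun y => ?_
    by_cases hy : y ∈ {y : ℝ | |y - c| ≤ C}
    · rw [Set.indicator_of_mem hy, Pi.one_apply, ← Real.exp_add]
      refine Real.one_le_exp ?_
      have h2 : |(y - c) / C| ≤ 1 := by
        rw [abs_div, abs_of_pos hC]
        exact div_le_one_of_le₀ hy hC.le
      have := (sq_le_one_iff_abs_le_one _).2 h2
      linarith
    · rw [Set.indicator_of_notMem hy]
      positivity
  refine h1.trans (mul_le_mul_of_nonneg_left ?_ (Real.exp_pos _).le)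
  have hprod : Integrable (Function.uncurry fun (y v : ℝ) =>
      Complex.exp (((y - c) / C : ℝ) * v * Complex.I)) (ν.prod (gaussianReal 0 1)) := by
    refine Integrable.of_bound (C := 1) (Measurable.aestronglyMeasurable (by fun_prop))
      (ae_of_all _ fun p => ?_)
    have := Complex.norm_exp_ofReal_mul_I ((p.1 - c) / C * p.2)
    push_cast at this
    simp only [Function.uncurry]
    push_cast
    exact this.le
  -- The kernel is itself the characteristic function of a standard Gaussian, so Fubini moves the
  -- integral onto `charFun ν`; the centre `c` survives only as a phase.
  have h2 : ((∫ y, Real.exp (-(((y - c) / C) ^ 2 / 2)) ∂ν : ℝ) : ℂ) =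
      ∫ v, Complex.exp (((-(v * c / C) : ℝ) : ℂ) * Complex.I) * charFun ν (v / C)
        ∂(gaussianReal 0 1) := by
    rw [← integral_complex_ofReal]
    calc ∫ y, ((Real.exp (-(((y - c) / C) ^ 2 / 2)) : ℝ) : ℂ) ∂ν
        = ∫ y, ∫ v, Complex.exp (((y - c) / C : ℝ) * v * Complex.I) ∂(gaussianReal 0 1) ∂ν := by
          refine integral_congr_ae (ae_of_all _ fun y => ?_)
          simp only []
          rw [← charFun_stdGaussianReal, charFun_apply_real]
      _ = ∫ v, ∫ y, Complex.exp (((y - c) / C : ℝ) * v * Complex.I) ∂ν ∂(gaussianReal 0 1) :=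
          integral_integral_swap hprod
      _ = _ := by
          refine integral_congr_ae (ae_of_all _ fun v => ?_)
          simp only []
          rw [charFun_apply_real, ← integral_const_mul]
          refine integral_congr_ae (ae_of_all _ fun y => ?_)
          simp only []
          rw [← Complex.exp_add]
          congr 1
          push_cast
          ring
  have h3 : (∫ y, Real.exp (-(((y - c) / C) ^ 2 / 2)) ∂ν) =
      ‖((∫ y, Real.exp (-(((y - c) / C) ^ 2 / 2)) ∂ν : ℝ) : ℂ)‖ := by
    rw [Complex.norm_real, Real.norm_of_nonneg]
    exact integral_nonneg fun y => (Real.exp_pos _).le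
  rw [h3, h2]
  refine (norm_integral_le_integral_norm _).trans_eq ?_
  refine integral_congr_ae (ae_of_all _ fun v => ?_)
  simp only [norm_mul, Complex.norm_exp_ofReal_mul_I, one_mul]

theorem exists_two_atoms {G : Measure ℕ} [IsProbabilityMeasure G]
    (hG : ∀ m : ℕ, G ≠ Measure.dirac m) : ∃ k l : ℕ, k < l ∧ G {k} ≠ 0 ∧ G {l} ≠ 0 := by
  obtain ⟨k, hk⟩ : ∃ k, G {k} ≠ 0 := by
    by_contra! h
    have : G = 0 := Measure.ext_of_singleton fun k => by simpa using h k
    exact IsProbabilityMeasure.ne_zero G this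
  obtain ⟨l, hlk, hl⟩ : ∃ l, l ≠ k ∧ G {l} ≠ 0 := by
    by_contra! h
    refine hG k (Measure.ext_of_singleton fun l => ?_)
    by_cases hlk : l = k
    · subst hlk
      have h2 : G {l}ᶜ = 0 := by
        rw [← Set.biUnion_of_singleton ({l}ᶜ : Set ℕ), measure_biUnion_null_iff (Set.to_countable _)]
        exact fun i hi => h i hi
      rw [prob_compl_eq_zero_iff (measurableSet_singleton l)] at h2
      simp [h2]
    · rw [h l hlk]
      simp [Ne.symm hlk]
  rcases lt_or_gt_of_ne hlk with h | h
  · exact ⟨l, k, h, hl, hk⟩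
  · exact ⟨k, l, h, hk, hl⟩

/-- The characteristic function of a non-degenerate law has modulus less than one close to zero. -/
theorem exists_norm_charFun_realLaw_lt_one {G : Measure ℕ} [IsProbabilityMeasure G]
    (hG : ∀ m : ℕ, G ≠ Measure.dirac m) :
    ∃ δ > 0, ∀ v : ℝ, 0 < v → v < δ → ‖charFun (realLaw G) v‖ < 1 := by
  obtain ⟨k, l, hkl, hk, hl⟩ := exists_two_atoms hG
  have hd : (0 : ℝ) < (l : ℝ) - k := sub_pos.2 (by exact_mod_cast hkl)
  -- For `v` below this bound the phases `v k` and `v l` differ by strictly less than a full turn,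
  -- so the two atoms cannot give the same value, as modulus one would require.
  refine ⟨2 * Real.pi / ((l : ℝ) - k), by positivity, fun v hv hv2 => ?_⟩
  rw [lt_div_iff₀ hd] at hv2
  have hchar : charFun (realLaw G) v = ∫ x : ℕ, Complex.exp ((v * x : ℝ) * Complex.I) ∂G := by
    rw [charFun_apply_real, realLaw, integral_map (by fun_prop) (by fun_prop)]
    push_cast
    rfl
  rw [hchar]
  have hb : ∀ᵐ x : ℕ ∂G, ‖Complex.exp ((v * x : ℝ) * Complex.I)‖ ≤ 1 :=
    ae_of_all _ fun x => (Complex.norm_exp_ofReal_mul_I _).le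
  rcases ae_eq_const_or_norm_integral_lt_of_norm_le_const hb with h | h
  · exfalso
    have key : ∀ m : ℕ, G {m} ≠ 0 → Complex.exp ((v * m : ℝ) * Complex.I) =
        ⨍ x : ℕ, Complex.exp ((v * x : ℝ) * Complex.I) ∂G := by
      intro m hm
      by_contra hne
      refine hm (measure_mono_null ?_ (ae_iff.1 h))
      rintro x rfl
      exact hne
    have heq := (key l hl).trans (key k hk).symm
    rw [Complex.exp_eq_exp_iff_exists_int] at heq
    obtain ⟨n, hn⟩ := heq
    have hn' : v * ((l : ℝ) - k) = n * (2 * Real.pi) := by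
      have h4 : (((v * ((l : ℝ) - k) : ℝ) : ℂ)) * Complex.I =
          ((n * (2 * Real.pi) : ℝ) : ℂ) * Complex.I := by
        push_cast at hn ⊢
        linear_combination hn
      exact_mod_cast mul_right_cancel₀ Complex.I_ne_zero h4
    have hpos : 0 < v * ((l : ℝ) - k) := mul_pos hv hd
    rw [hn'] at hpos hv2
    have h5 : (0 : ℝ) < n := by
      by_contra hc
      push Not at hc
      nlinarith [Real.pi_pos]
    have h6 : (n : ℝ) < 1 := by
      by_contra hc
      push Not at hc
      nlinarith [Real.pi_pos]
    have h7 : 0 < n := by exact_mod_cast h5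
    have h8 : n < 1 := by exact_mod_cast h6
    omega
  · simpa using h

/-- A positive fraction of the points `t / n` lies in the compact interval `[s/2, s]`, where `g` is
bounded by its maximum, which is below one; the remaining factors are at most one. -/
theorem tendsto_prod_div_of_lt_one {g : ℝ → ℝ} (hg : Continuous g) (h0 : ∀ x, 0 ≤ g x)
    (h1 : ∀ x, g x ≤ 1) {s : ℝ} (hs : 0 < s) (hs1 : s ≤ 1)
    (hlt : ∀ x, 0 < x → x ≤ s → g x < 1) :
    Tendsto (fun n : ℕ => ∏ t ∈ Finset.range n, g ((t : ℝ) / n)) atTop (𝓝 0) := by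
  obtain ⟨x₀, hx₀, hmax⟩ := isCompact_Icc.exists_isMaxOn
    (Set.nonempty_Icc.2 (by linarith : s / 2 ≤ s)) hg.continuousOn
  have hρ : g x₀ < 1 := hlt x₀ (by linarith [hx₀.1]) hx₀.2
  have hcard : Tendsto (fun n : ℕ => ⌊s * n⌋₊ - ⌈s / 2 * n⌉₊) atTop atTop := by
    refine tendsto_atTop.2 fun m => ?_
    obtain ⟨n₀, hn₀⟩ := exists_nat_ge ((m + 2) / (s / 2))
    filter_upwards [eventually_ge_atTop n₀] with n hn
    -- The extra `2` absorbs the two roundings at the ends of the interval.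
    have h2 : (m + 2 : ℝ) ≤ s / 2 * n := by
      rw [div_le_iff₀ (by positivity)] at hn₀
      have : (n₀ : ℝ) ≤ n := by exact_mod_cast hn
      nlinarith
    have h3 := Nat.lt_floor_add_one (s * n)
    have h4 := Nat.ceil_lt_add_one (show 0 ≤ s / 2 * (n : ℝ) by positivity)
    have h5 : ((m + ⌈s / 2 * n⌉₊ : ℕ) : ℝ) < (⌊s * n⌋₊ + 1 : ℕ) := by
      push_cast
      linarith
    have h6 : m + ⌈s / 2 * (n : ℝ)⌉₊ < ⌊s * (n : ℝ)⌋₊ + 1 := by exact_mod_cast h5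
    omega
  refine squeeze_zero' (Eventually.of_forall fun n => Finset.prod_nonneg fun t _ => h0 _) ?_
    ((tendsto_pow_atTop_nhds_zero_of_lt_one (h0 x₀) hρ).comp hcard)
  filter_upwards [eventually_gt_atTop 0] with n hn
  have hn' : (0 : ℝ) < n := by exact_mod_cast hn
  have hsub : Finset.Ico ⌈s / 2 * n⌉₊ ⌊s * n⌋₊ ⊆ Finset.range n := by
    intro t ht
    rw [Finset.mem_Ico] at ht
    rw [Finset.mem_range]
    refine ht.2.trans_le (Nat.floor_le_of_le ?_)
    nlinarith
  calc ∏ t ∈ Finset.range n, g ((t : ℝ) / n)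
      ≤ ∏ t ∈ Finset.Ico ⌈s / 2 * n⌉₊ ⌊s * n⌋₊, g ((t : ℝ) / n) :=
        Finset.prod_le_prod_of_subset_of_le_one hsub (fun _ _ => h0 _) fun _ _ _ => h1 _
    _ ≤ ∏ _t ∈ Finset.Ico ⌈s / 2 * n⌉₊ ⌊s * n⌋₊, g x₀ := by
        refine Finset.prod_le_prod (fun _ _ => h0 _) fun t ht => hmax ?_
        rw [Finset.mem_Ico] at ht
        constructor
        · rw [le_div_iff₀ hn']
          exact Nat.ceil_le.1 ht.1
        · rw [div_le_iff₀ hn']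
          exact (Nat.le_floor_iff (by positivity)).1 ht.2.le
    _ = _ := by simp

theorem tendsto_prod_norm_charFun {G : Measure ℕ} [IsProbabilityMeasure G]
    (hG : ∀ m : ℕ, G ≠ Measure.dirac m) {u : ℝ} (hu : u ≠ 0) :
    Tendsto (fun n : ℕ => ∏ t ∈ Finset.range n, ‖charFun (realLaw G) (((t : ℝ) / n) * u)‖)
      atTop (𝓝 0) := by
  obtain ⟨δ, hδ, hlt⟩ := exists_norm_charFun_realLaw_lt_one hG
  have habs : ∀ x : ℝ, ‖charFun (realLaw G) |x|‖ = ‖charFun (realLaw G) x‖ := by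
    intro x
    rcases abs_choice x with h | h <;> rw [h]
    rw [charFun_neg, RCLike.norm_conj]
  have hu' : 0 < |u| := abs_pos.2 hu
  have hs : 0 < min 1 (δ / (2 * |u|)) := lt_min one_pos (by positivity)
  refine tendsto_prod_div_of_lt_one (g := fun x => ‖charFun (realLaw G) (x * u)‖)
    (by have := continuous_charFun (μ := realLaw G); fun_prop) (fun _ => norm_nonneg _)
    (fun _ => norm_charFun_le_one _) hs (min_le_left _ _) fun x hx hxs => ?_
  rw [← habs, abs_mul, abs_of_pos hx]
  refine hlt _ (by positivity) ?_
  have h3 := hxs.trans (min_le_right _ _)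
  rw [le_div_iff₀ (by positivity)] at h3
  linarith

/-- The normalised linear form `∑_{t < n} (t / n) e_t` in i.i.d. non-degenerate variables has
no concentration at bounded scales. -/
theorem tendsto_measureReal_weightedSum {G : Measure ℕ} [IsProbabilityMeasure G]
    (hG : ∀ m : ℕ, G ≠ Measure.dirac m) (c : ℕ → ℝ) {C : ℝ} (hC : 0 < C) :
    Tendsto (fun n : ℕ => (Measure.infinitePi fun _ : ℕ => G).real
      {e | |∑ t ∈ Finset.range n, (t : ℝ) / n * (e t : ℝ) - c n| ≤ C}) atTop (𝓝 0) := by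
  set Q := Measure.infinitePi fun _ : ℕ => G
  have hmeas : ∀ n : ℕ, Measurable fun e : ℕ → ℕ =>
      ∑ t ∈ Finset.range n, (t : ℝ) / n * (e t : ℝ) := fun n => by fun_prop
  have hcoord : ∀ t : ℕ, Measurable fun e : ℕ → ℕ => (e t : ℝ) := fun t =>
    measurable_from_nat.comp (measurable_pi_apply t)
  have hmap : ∀ t : ℕ, Q.map (fun e => (e t : ℝ)) = realLaw G := fun t => by
    have := Measure.infinitePi_map_eval (fun _ : ℕ => G) t
    rw [realLaw, ← this, Measure.map_map (by fun_prop) (by fun_prop)]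
    rfl
  let ν : ℕ → Measure ℝ := fun n =>
    Q.map fun e : ℕ → ℕ => ∑ t ∈ Finset.range n, (t : ℝ) / n * (e t : ℝ)
  have hν : ∀ n, IsProbabilityMeasure (ν n) := fun n =>
    Measure.isProbabilityMeasure_map (hmeas n).aemeasurable
  have hchar : ∀ (n : ℕ) (u : ℝ), charFun (ν n) u =
      ∏ t ∈ Finset.range n, charFun (realLaw G) ((t : ℝ) / n * u) := by
    intro n u
    have hind : iIndepFun (fun (t : ℕ) (e : ℕ → ℕ) => (t : ℝ) / n * (e t : ℝ)) Q :=
      iIndepFun_infinitePi (P := fun _ : ℕ => G) (X := fun (t : ℕ) (k : ℕ) => (t : ℝ) / n * (k : ℝ))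
        fun t => by fun_prop
    have := iIndepFun.charFun_map_fun_finsetSum_eq_prod (s := Finset.range n)
      (X := fun (t : ℕ) (e : ℕ → ℕ) => (t : ℝ) / n * (e t : ℝ)) (P := Q)
      (fun t _ => ((hcoord t).const_mul _).aemeasurable) (hind.restrict _)
    simp only [ν]
    rw [this, Finset.prod_apply]
    refine Finset.prod_congr rfl fun t _ => ?_
    rw [charFun_map_mul_comp (hcoord t).aemeasurable, hmap]
  have hint : Tendsto (fun n => ∫ v, ‖charFun (ν n) (v / C)‖ ∂(gaussianReal 0 1)) atTop (𝓝 0) := by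
    have h0 : (0 : ℝ) = ∫ _v : ℝ, (0 : ℝ) ∂(gaussianReal 0 1) := by simp
    conv => enter [3, 1]; rw [h0]
    refine tendsto_integral_of_dominated_convergence (fun _ => 1) (fun n => ?_)
      (integrable_const _) (fun n => ae_of_all _ fun v => ?_) ?_
    · have := hν n
      have := measurable_charFun (μ := ν n)
      exact Measurable.aestronglyMeasurable (by fun_prop)
    · have := hν n
      rw [norm_norm]
      exact norm_charFun_le_one _
    -- The pointwise limit fails only at `v = 0`, which the Gaussian does not charge.
    · have := nullSingletonClass_gaussianReal (μ := 0) (v := 1) one_ne_zero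
      have hne : ∀ᵐ v ∂(gaussianReal 0 1), v ≠ 0 := by
        rw [ae_iff]
        simp
      filter_upwards [hne] with v hv
      simp only [hchar, norm_prod]
      exact tendsto_prod_norm_charFun hG (div_ne_zero hv hC.ne')
  have hle : ∀ n : ℕ, Q.real {e | |∑ t ∈ Finset.range n, (t : ℝ) / n * (e t : ℝ) - c n| ≤ C} ≤
      Real.exp (1 / 2) * ∫ v, ‖charFun (ν n) (v / C)‖ ∂(gaussianReal 0 1) := by
    intro n
    have := hν n
    refine le_trans (le_of_eq ?_)
      (measureReal_abs_sub_le_integral_norm_charFun (ν n) (c n) hC)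
    rw [map_measureReal_apply (hmeas n) (measurableSet_le (by fun_prop) (by fun_prop))]
    rfl
  refine squeeze_zero (fun _ => measureReal_nonneg) hle ?_
  simpa using hint.const_mul (Real.exp (1 / 2))

/-! ### Moment bounds for the innovations -/

/-- The law of the innovation sequence. -/
abbrev innovLaw (G : Measure ℕ) [IsProbabilityMeasure G] : Measure (ℕ → ℕ) :=
  Measure.infinitePi fun _ : ℕ => G

theorem measurePreserving_innov (G : Measure ℕ) [IsProbabilityMeasure G] (t : ℕ) :
    MeasurePreserving (fun e : ℕ → ℕ => e t) (innovLaw G) G :=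
  measurePreserving_eval_infinitePi (fun _ : ℕ => G) t

/-- The variance of the immigration distribution. -/
def var (G : Measure ℕ) : ℝ := ∫ k, ((k : ℝ) - mean G) ^ 2 ∂G

section Moments

variable {G : Measure ℕ}

theorem integrable_of_cube (hG3 : Integrable (fun k : ℕ => (k : ℝ) ^ 3) G) :
    Integrable (fun k : ℕ => (k : ℝ)) G := by
  refine hG3.mono' (by fun_prop) (ae_of_all _ fun k => ?_)
  rw [Real.norm_of_nonneg (by positivity)]
  exact_mod_cast Nat.le_self_pow (by norm_num) k

/-- The main argument uses the third moment only through this consequence: for natural numbers `k² ≤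
k³`. -/
theorem memLp_two_of_cube (hG3 : Integrable (fun k : ℕ => (k : ℝ) ^ 3) G) :
    MemLp (fun k : ℕ => (k : ℝ)) 2 G := by
  rw [memLp_two_iff_integrable_sq (by fun_prop)]
  refine hG3.mono' (by fun_prop) (ae_of_all _ fun k => ?_)
  rw [Real.norm_of_nonneg (by positivity)]
  rcases Nat.eq_zero_or_pos k with rfl | hk
  · simp
  · exact pow_le_pow_right₀ (by exact_mod_cast hk) (by norm_num)

theorem mean_nonneg : 0 ≤ mean G := integral_nonneg fun k => by positivity

variable [IsProbabilityMeasure G]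

theorem mean_pos (hG : ∀ m : ℕ, G ≠ Measure.dirac m)
    (hint : Integrable (fun k : ℕ => (k : ℝ)) G) : 0 < mean G := by
  obtain ⟨k, l, hkl, -, hl⟩ := exists_two_atoms hG
  rw [mean, integral_pos_iff_support_of_nonneg (fun k => by positivity) hint]
  refine (pos_iff_ne_zero.2 hl).trans_le (measure_mono ?_)
  rintro x rfl
  simp only [Function.mem_support]
  exact_mod_cast (by omega : x ≠ 0)

theorem integrable_innov (hint : Integrable (fun k : ℕ => (k : ℝ)) G) (t : ℕ) :
    Integrable (fun e : ℕ → ℕ => (e t : ℝ)) (innovLaw G) :=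
  (measurePreserving_innov G t).integrable_comp_of_integrable hint

theorem integral_comp_innov (f : ℕ → ℝ) (t : ℕ) :
    ∫ e, f (e t) ∂(innovLaw G) = ∫ k, f k ∂G := by
  have h := integral_map (μ := innovLaw G) (φ := fun e : ℕ → ℕ => e t) (f := f)
    (measurable_pi_apply t).aemeasurable measurable_from_nat.aestronglyMeasurable
  rw [(measurePreserving_innov G t).map_eq] at h
  exact h.symm

theorem integral_innov (t : ℕ) : ∫ e, (e t : ℝ) ∂(innovLaw G) = mean G :=
  integral_comp_innov (fun k => (k : ℝ)) t

theorem memLp_centered (h2 : MemLp (fun k : ℕ => (k : ℝ)) 2 G) (t : ℕ) :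
    MemLp (fun e : ℕ → ℕ => (e t : ℝ) - mean G) 2 (innovLaw G) :=
  (h2.sub (memLp_const (mean G))).comp_measurePreserving (measurePreserving_innov G t)

theorem integral_centered_sq (t : ℕ) :
    ∫ e, ((e t : ℝ) - mean G) ^ 2 ∂(innovLaw G) = var G :=
  integral_comp_innov (fun k => ((k : ℝ) - mean G) ^ 2) t

theorem integral_sum_innov (hint : Integrable (fun k : ℕ => (k : ℝ)) G) (n : ℕ) :
    ∫ e, ∑ t ∈ Finset.range n, (e t : ℝ) ∂(innovLaw G) = n * mean G := by
  rw [integral_finsetSum _ fun t _ => integrable_innov hint t]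
  simp [integral_innov]

theorem integral_sum_centered_sq (h2 : MemLp (fun k : ℕ => (k : ℝ)) 2 G) (n : ℕ) :
    ∫ e, ∑ t ∈ Finset.range n, ((e t : ℝ) - mean G) ^ 2 ∂(innovLaw G) = n * var G := by
  rw [integral_finsetSum _ fun t _ => (memLp_centered h2 t).integrable_sq]
  simp [integral_centered_sq]

theorem integral_sq_sum_centered (h2 : MemLp (fun k : ℕ => (k : ℝ)) 2 G) (n : ℕ) :
    ∫ e, (∑ t ∈ Finset.range n, ((e t : ℝ) - mean G)) ^ 2 ∂(innovLaw G) = n * var G := by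
  have hint := h2.integrable (by norm_num)
  have h0 : ∀ t : ℕ, ∫ e, ((e t : ℝ) - mean G) ∂(innovLaw G) = 0 := fun t => by
    rw [integral_sub (integrable_innov hint t) (integrable_const _), integral_innov]
    simp
  have hind : iIndepFun (fun (t : ℕ) (e : ℕ → ℕ) => (e t : ℝ) - mean G) (innovLaw G) :=
    iIndepFun_infinitePi (P := fun _ : ℕ => G) (X := fun (_ : ℕ) (k : ℕ) => (k : ℝ) - mean G)
      fun t => by fun_prop
  have hvar := IndepFun.variance_sum (s := Finset.range n) (μ := innovLaw G)
    (X := fun (t : ℕ) (e : ℕ → ℕ) => (e t : ℝ) - mean G) (fun t _ => memLp_centered h2 t)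
    fun i _ j _ hij => hind.indepFun hij
  have hV : ∀ t : ℕ, Var[fun e : ℕ → ℕ => (e t : ℝ) - mean G; innovLaw G] = var G := fun t => by
    rw [variance_of_integral_eq_zero (memLp_centered h2 t).aemeasurable (h0 t),
      integral_centered_sq]
  have hsum : (∑ t ∈ Finset.range n, fun e : ℕ → ℕ => (e t : ℝ) - mean G) =
      fun e => ∑ t ∈ Finset.range n, ((e t : ℝ) - mean G) := by
    ext e
    simp
  rw [hsum, variance_of_integral_eq_zero] at hvar
  · rw [hvar]
    simp [hV]
  · exact Finset.aemeasurable_fun_sum _ fun t _ => (memLp_centered h2 t).aemeasurable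
  · rw [integral_finsetSum _ fun t _ => (memLp_centered h2 t).integrable (by norm_num)]
    simp [h0]

/-- Markov's inequality at level `K n`; the factor `n` cancels, so the bound is uniform in `n`. -/
theorem measureReal_gt_le_of_integral {Ω : Type*} [MeasurableSpace Ω] {P : Measure Ω}
    [IsProbabilityMeasure P] {f : Ω → ℝ} (hf : ∀ x, 0 ≤ f x) (hint : Integrable f P) {n : ℕ}
    (hn : 0 < n) {a K : ℝ} (hK : 0 < K) (h : ∫ x, f x ∂P = n * a) :
    P.real {x | K * n < f x} ≤ a / K := by
  have hn' : (0 : ℝ) < n := by exact_mod_cast hn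
  have h1 := mul_meas_ge_le_integral_of_nonneg (ae_of_all _ hf) hint (K * n)
  have h2 : P.real {x | K * n < f x} ≤ P.real {x | K * n ≤ f x} :=
    measureReal_mono fun x (hx : K * n < f x) => hx.le
  rw [h] at h1
  rw [le_div_iff₀ hK]
  refine le_of_mul_le_mul_left (le_trans (le_of_eq ?_) ((mul_le_mul_of_nonneg_left h2
    (by positivity : 0 ≤ K * (n : ℝ))).trans h1)) hn'
  ring

theorem measureReal_sum_innov_gt (hint : Integrable (fun k : ℕ => (k : ℝ)) G) {n : ℕ}
    (hn : 0 < n) {K : ℝ} (hK : 0 < K) :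
    (innovLaw G).real {e | K * n < ∑ t ∈ Finset.range n, (e t : ℝ)} ≤ mean G / K :=
  measureReal_gt_le_of_integral (fun e => Finset.sum_nonneg fun t _ => by positivity)
    (integrable_finsetSum _ fun t _ => integrable_innov hint t) hn hK (integral_sum_innov hint n)

theorem measureReal_sum_centered_sq_gt (h2 : MemLp (fun k : ℕ => (k : ℝ)) 2 G) {n : ℕ}
    (hn : 0 < n) {K : ℝ} (hK : 0 < K) :
    (innovLaw G).real {e | K * n < ∑ t ∈ Finset.range n, ((e t : ℝ) - mean G) ^ 2} ≤ var G / K :=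
  measureReal_gt_le_of_integral (fun _ => Finset.sum_nonneg fun _ _ => sq_nonneg _)
    (integrable_finsetSum _ fun t _ => (memLp_centered h2 t).integrable_sq) hn hK
    (integral_sum_centered_sq h2 n)

theorem measureReal_sq_sum_centered_gt (h2 : MemLp (fun k : ℕ => (k : ℝ)) 2 G) {n : ℕ}
    (hn : 0 < n) {K : ℝ} (hK : 0 < K) :
    (innovLaw G).real {e | K * n < (∑ t ∈ Finset.range n, ((e t : ℝ) - mean G)) ^ 2} ≤
      var G / K :=
  measureReal_gt_le_of_integral (fun _ => sq_nonneg _)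
    (memLp_finsetSum _ fun t _ => memLp_centered h2 t).integrable_sq hn hK
    (integral_sq_sum_centered h2 n)

end Moments

/-! ### Expected number of failures -/

/-- The number of failures among the survival indicators `Z_{j+1}^{(t+1)}`, `t < n`,
`j < e_0 + ⋯ + e_{t-1}`, an upper bound for the number of deaths up to time `n`. -/
def failures (n : ℕ) (ω : Sample) : ℕ :=
  ∑ t ∈ Finset.range n, ∑ j ∈ Finset.range (∑ s ∈ Finset.range t, ω.1 s), (1 - ω.2 (t, j))

theorem measurable_failures (n : ℕ) : Measurable (failures n) := by
  unfold failures
  refine Finset.measurable_sum _ fun t _ => ?_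
  have hN : Measurable fun ω : Sample => ∑ s ∈ Finset.range t, ω.1 s := by fun_prop
  -- The random length of the sum is made a separate countable coordinate, so that measurability is
  -- checked at each fixed length.
  have hF : Measurable fun p : Sample × ℕ => ∑ j ∈ Finset.range p.2, (1 - p.1.2 (t, j)) := by
    refine measurable_from_prod_countable_left fun m => ?_
    have hj : ∀ j : ℕ, Measurable fun ω : Sample => 1 - ω.2 (t, j) := fun j =>
      (measurable_from_nat (f := fun k : ℕ => 1 - k)).comp
        ((measurable_pi_apply (t, j)).comp measurable_snd)
    exact Finset.measurable_sum (Finset.range m) fun j _ => hj j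
  exact hF.comp (measurable_id.prodMk hN)

theorem lintegral_one_sub_bernoulli (θ : I) :
    ∫⁻ k : ℕ, ((1 - k : ℕ) : ENNReal) ∂(bernoulliMeasure (1 : ℕ) 0 θ) =
      ENNReal.ofReal (1 - (θ : ℝ)) := by
  rw [bernoulliMeasure_def, lintegral_add_measure, lintegral_smul_measure, lintegral_smul_measure,
    lintegral_dirac, lintegral_dirac]
  simp only [tsub_self, Nat.cast_zero, smul_zero, zero_add, tsub_zero, Nat.cast_one]
  rw [ENNReal.smul_def, smul_eq_mul, mul_one, ENNReal.ofReal]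
  congr 1
  ext
  rw [Real.coe_toNNReal _ (sub_nonneg.2 θ.2.2)]
  rfl

/-- The number of indicators inspected depends on the innovations alone, so with these fixed each
one fails with probability `1 - θ`. On average `t * mean G` indicators are inspected at time `t`,
and `t ≤ n` gives the factor `n²` that cancels the one in `h / n²`. -/
theorem lintegral_failures_le (θ : I) {G : Measure ℕ} [IsProbabilityMeasure G]
    (hint : Integrable (fun k : ℕ => (k : ℝ)) G) (n : ℕ) :
    ∫⁻ ω, (failures n ω : ENNReal) ∂(prob θ G) ≤
      ENNReal.ofReal ((1 - (θ : ℝ)) * (n ^ 2 * mean G)) := by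
  have hθ : 0 ≤ 1 - (θ : ℝ) := sub_nonneg.2 θ.2.2
  have hz : ∀ p : ℕ × ℕ, ∫⁻ z : ℕ × ℕ → ℕ, ((1 - z p : ℕ) : ENNReal)
      ∂(Measure.infinitePi fun _ : ℕ × ℕ => bernoulliMeasure (1 : ℕ) 0 θ) =
      ENNReal.ofReal (1 - (θ : ℝ)) := fun p => by
    rw [← lintegral_one_sub_bernoulli]
    exact (measurePreserving_eval_infinitePi
      (fun _ : ℕ × ℕ => bernoulliMeasure (1 : ℕ) 0 θ) p).lintegral_comp
        (f := fun k : ℕ => ((1 - k : ℕ) : ENNReal)) measurable_from_nat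
  have he : ∀ t : ℕ, ∫⁻ e : ℕ → ℕ, (e t : ENNReal) ∂(innovLaw G) = ENNReal.ofReal (mean G) :=
    fun t => by
      rw [← integral_innov (G := G) t, ofReal_integral_eq_lintegral_ofReal
        (integrable_innov hint t) (ae_of_all _ fun e => Nat.cast_nonneg _)]
      simp
  have hmz : ∀ p : ℕ × ℕ, Measurable fun z : ℕ × ℕ → ℕ => ((1 - z p : ℕ) : ENNReal) := fun p =>
    (measurable_from_nat (f := fun k : ℕ => ((1 - k : ℕ) : ENNReal))).comp (measurable_pi_apply p)
  have hme : ∀ t : ℕ, Measurable fun e : ℕ → ℕ => (e t : ENNReal) := fun t =>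
    measurable_from_nat.comp (measurable_pi_apply t)
  have hmf : Measurable fun ω : Sample => (failures n ω : ENNReal) :=
    measurable_from_nat.comp (measurable_failures n)
  rw [prob, lintegral_prod _ hmf.aemeasurable]
  calc ∫⁻ e, ∫⁻ z, (failures n (e, z) : ENNReal)
        ∂(Measure.infinitePi fun _ : ℕ × ℕ => bernoulliMeasure (1 : ℕ) 0 θ) ∂(innovLaw G)
      = ∫⁻ e, ∑ t ∈ Finset.range n, (∑ s ∈ Finset.range t, (e s : ENNReal)) *
          ENNReal.ofReal (1 - (θ : ℝ)) ∂(innovLaw G) := by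
        refine lintegral_congr fun e => ?_
        simp only [failures, Nat.cast_sum]
        rw [lintegral_finsetSum _ fun t _ => Finset.measurable_sum _ fun j _ => hmz (t, j)]
        refine Finset.sum_congr rfl fun t _ => ?_
        rw [lintegral_finsetSum _ fun j _ => hmz (t, j), Finset.sum_congr rfl fun j _ => hz (t, j)]
        simp
    _ = ∑ t ∈ Finset.range n, (t : ENNReal) * ENNReal.ofReal (mean G) *
          ENNReal.ofReal (1 - (θ : ℝ)) := by
        rw [lintegral_finsetSum _ fun t _ =>
          (Finset.measurable_sum _ fun s _ => hme s).mul_const _]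
        refine Finset.sum_congr rfl fun t _ => ?_
        rw [lintegral_mul_const _ (Finset.measurable_sum _ fun s _ => hme s),
          lintegral_finsetSum _ fun s _ => hme s]
        simp [he]
    _ ≤ ∑ t ∈ Finset.range n, (n : ENNReal) * ENNReal.ofReal (mean G) *
          ENNReal.ofReal (1 - (θ : ℝ)) := by
        refine Finset.sum_le_sum fun t ht => ?_
        gcongr
        exact (Finset.mem_range.1 ht).le
    _ = _ := by
        rw [Finset.sum_const, Finset.card_range, nsmul_eq_mul, ← ENNReal.ofReal_natCast,
          ← ENNReal.ofReal_mul (by positivity), ← ENNReal.ofReal_mul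
            (mul_nonneg (by positivity) mean_nonneg), ← ENNReal.ofReal_mul (by positivity)]
        congr 1
        ring

theorem measureReal_failures_gt (θ : I) {G : Measure ℕ} [IsProbabilityMeasure G]
    (hint : Integrable (fun k : ℕ => (k : ℝ)) G) {n : ℕ} {a K : ℝ} (hK : 0 < K)
    (ha : (1 - (θ : ℝ)) * (n ^ 2 * mean G) ≤ a) :
    (prob θ G).real {ω | K < (failures n ω : ℝ)} ≤ a / K := by
  have hmf : Measurable fun ω : Sample => (failures n ω : ENNReal) :=
    measurable_from_nat.comp (measurable_failures n)
  have ha0 : 0 ≤ a :=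
    le_trans (mul_nonneg (sub_nonneg.2 θ.2.2) (mul_nonneg (by positivity) mean_nonneg)) ha
  have h1 := meas_ge_le_lintegral_div (μ := prob θ G)
    hmf.aemeasurable
    (ε := ENNReal.ofReal K) (by simpa using hK) ENNReal.ofReal_ne_top
  have h2 : prob θ G {ω | K < (failures n ω : ℝ)} ≤ ENNReal.ofReal (a / K) := by
    rw [ENNReal.ofReal_div_of_pos hK]
    refine (measure_mono fun ω hω => ?_).trans (h1.trans (ENNReal.div_le_div_right
      ((lintegral_failures_le θ hint n).trans (ENNReal.ofReal_le_ofReal ha)) _))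
    simp only [Set.mem_ofPred_eq] at hω ⊢
    rw [← ENNReal.ofReal_natCast]
    exact ENNReal.ofReal_le_ofReal hω.le
  exact ENNReal.toReal_le_of_le_ofReal (by positivity) h2

/-! ### Pathwise comparison with the random walk -/

section Paths

variable {ω : Sample}

theorem X_succ (ω : Sample) (t : ℕ) :
    X ω (t + 1) = (∑ j ∈ Finset.range (X ω t), ω.2 (t, j)) + ω.1 t := rfl

theorem X_succ_le (hω : ∀ p, ω.2 p ≤ 1) (t : ℕ) : X ω (t + 1) ≤ X ω t + ω.1 t := by
  rw [X_succ]
  have : ∑ j ∈ Finset.range (X ω t), ω.2 (t, j) ≤ ∑ _j ∈ Finset.range (X ω t), 1 :=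
    Finset.sum_le_sum fun j _ => hω _
  simp only [Finset.sum_const, Finset.card_range, smul_eq_mul, mul_one] at this
  omega

theorem X_le_sum (hω : ∀ p, ω.2 p ≤ 1) (t : ℕ) : X ω t ≤ ∑ s ∈ Finset.range t, ω.1 s := by
  induction t with
  | zero => simp [X]
  | succ t ih =>
    rw [Finset.sum_range_succ]
    have := X_succ_le hω t
    omega

/-- Each arrival is either still alive or has died, and the deaths at each step are failures among
the first `X ω t` indicators, which are among those that `failures` counts. -/
theorem sum_le_X_add_failures (hω : ∀ p, ω.2 p ≤ 1) (n : ℕ) :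
    ∑ s ∈ Finset.range n, ω.1 s ≤ X ω n + failures n ω := by
  induction n with
  | zero => simp
  | succ n ih =>
    have h1 : failures (n + 1) ω = failures n ω +
        ∑ j ∈ Finset.range (∑ s ∈ Finset.range n, ω.1 s), (1 - ω.2 (n, j)) :=
      Finset.sum_range_succ _ _
    have h2 : ∑ j ∈ Finset.range (X ω n), (1 - ω.2 (n, j)) ≤
        ∑ j ∈ Finset.range (∑ s ∈ Finset.range n, ω.1 s), (1 - ω.2 (n, j)) :=
      Finset.sum_le_sum_of_subset (Finset.range_subset_range.2 (X_le_sum hω n))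
    have h3 : ∑ j ∈ Finset.range (X ω n), (1 - ω.2 (n, j)) +
        ∑ j ∈ Finset.range (X ω n), ω.2 (n, j) = X ω n := by
      rw [← Finset.sum_add_distrib, Finset.sum_congr rfl fun j _ => Nat.sub_add_cancel (hω (n, j))]
      simp
    rw [Finset.sum_range_succ, X_succ, h1]
    omega

end Paths

/-- Second-order expansion of the stochastic integral of a random walk against its own
centred increments. -/
theorem sum_walk_mul_centered (e : ℕ → ℝ) (m : ℝ) (n : ℕ) :
    ∑ t ∈ Finset.range n, (∑ s ∈ Finset.range t, e s) * (e t - m) =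
      m * ∑ t ∈ Finset.range n, (t : ℝ) * (e t - m) +
        ((∑ t ∈ Finset.range n, (e t - m)) ^ 2 - ∑ t ∈ Finset.range n, (e t - m) ^ 2) / 2 := by
  induction n with
  | zero => simp
  | succ n ih =>
    have h : ∑ t ∈ Finset.range n, (e t - m) = ∑ t ∈ Finset.range n, e t - n * m := by
      simp [Finset.sum_sub_distrib]
    simp only [Finset.sum_range_succ]
    rw [ih, h]
    ring

/-- The linear form in the innovations is controlled by the numerator of `1 - θ̂` and lower order
terms, on any path of a process that loses at most `B` individuals. -/
theorem mul_abs_linearForm_le {x e : ℕ → ℝ} {m B : ℝ} {n : ℕ} (hx : ∀ t, 0 ≤ x t) (hx0 : x 0 = 0)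
    (he : ∀ t, 0 ≤ e t) (hm : 0 ≤ m) (hstep : ∀ t, x (t + 1) ≤ x t + e t)
    (hB : ∑ t ∈ Finset.range n, e t ≤ x n + B) :
    m * |∑ t ∈ Finset.range n, (t : ℝ) * (e t - m)| ≤
      |∑ t ∈ Finset.range n, x t * (x t - x (t + 1) + m)| +
        B * (2 * ∑ t ∈ Finset.range n, e t + n * m) +
        ((∑ t ∈ Finset.range n, (e t - m)) ^ 2 + ∑ t ∈ Finset.range n, (e t - m) ^ 2) / 2 := by
  set S : ℕ → ℝ := fun t => ∑ s ∈ Finset.range t, e s with hS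
  have hSsucc : ∀ t, S (t + 1) = S t + e t := fun t => Finset.sum_range_succ _ _
  have hSmono : Monotone S := monotone_nat_of_le_succ fun t => by linarith [hSsucc t, he t]
  -- `S - x` is the cumulative number of deaths, hence nondecreasing and at most `B` up to time `n`.
  have hAmono : Monotone fun t => S t - x t :=
    monotone_nat_of_le_succ fun t => by linarith [hSsucc t, hstep t]
  have hA0 : ∀ t, 0 ≤ S t - x t := fun t => by
    have := hAmono (Nat.zero_le t)
    simpa [hS, hx0] using this
  have hAB : ∀ t ≤ n, S t - x t ≤ B := fun t ht => by
    have := hAmono ht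
    simp only at this
    have hB' : S n ≤ x n + B := hB
    linarith
  have hB0 : 0 ≤ B := (hA0 n).trans (hAB n le_rfl)
  have hSn : 0 ≤ S n := Finset.sum_nonneg fun t _ => he t
  -- The three sums are the deaths weighted by population, the error of replacing `x` by `S`, and
  -- the martingale-type sum of the walk.
  have hdecomp : ∑ t ∈ Finset.range n, x t * (x t - x (t + 1) + m) =
      ∑ t ∈ Finset.range n, x t * (x t + e t - x (t + 1)) +
      ∑ t ∈ Finset.range n, (S t - x t) * (e t - m) - ∑ t ∈ Finset.range n, S t * (e t - m) := by
    rw [← Finset.sum_add_distrib, ← Finset.sum_sub_distrib]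
    exact Finset.sum_congr rfl fun t _ => by ring
  have hdeaths : ∑ t ∈ Finset.range n, (x t + e t - x (t + 1)) = S n - x n := by
    have h1 := Finset.sum_range_sub x n
    have h2 : ∑ t ∈ Finset.range n, (x t + e t - x (t + 1)) =
        S n - ∑ t ∈ Finset.range n, (x (t + 1) - x t) := by
      rw [hS, ← Finset.sum_sub_distrib]
      exact Finset.sum_congr rfl fun t _ => by ring
    rw [h2, h1, hx0, sub_zero]
  have h1 : |∑ t ∈ Finset.range n, x t * (x t + e t - x (t + 1))| ≤ B * S n := by
    rw [abs_of_nonneg (Finset.sum_nonneg fun t _ => mul_nonneg (hx t) (by linarith [hstep t]))]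
    calc ∑ t ∈ Finset.range n, x t * (x t + e t - x (t + 1))
        ≤ ∑ t ∈ Finset.range n, S n * (x t + e t - x (t + 1)) := by
          refine Finset.sum_le_sum fun t ht => ?_
          have ht' := (Finset.mem_range.1 ht).le
          exact mul_le_mul_of_nonneg_right (by linarith [hA0 t, hSmono ht'])
            (by linarith [hstep t])
      _ = S n * (S n - x n) := by rw [← Finset.mul_sum, hdeaths]
      _ ≤ B * S n := by
          rw [mul_comm]
          exact mul_le_mul_of_nonneg_right (hAB n le_rfl) hSn
  have h2 : |∑ t ∈ Finset.range n, (S t - x t) * (e t - m)| ≤ B * (S n + n * m) := by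
    calc |∑ t ∈ Finset.range n, (S t - x t) * (e t - m)|
        ≤ ∑ t ∈ Finset.range n, |(S t - x t) * (e t - m)| := Finset.abs_sum_le_sum_abs _ _
      _ ≤ ∑ t ∈ Finset.range n, B * (e t + m) := by
          refine Finset.sum_le_sum fun t ht => ?_
          rw [abs_mul, abs_of_nonneg (hA0 t)]
          refine mul_le_mul (hAB t (Finset.mem_range.1 ht).le) ?_ (abs_nonneg _) hB0
          exact abs_le.2 ⟨by linarith [he t], by linarith⟩
      _ = B * (S n + n * m) := by
          rw [← Finset.mul_sum, Finset.sum_add_distrib]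
          simp [hS]
  have h3 := sum_walk_mul_centered e m n
  have h4 : 0 ≤ ∑ t ∈ Finset.range n, (e t - m) ^ 2 := Finset.sum_nonneg fun t _ => sq_nonneg _
  have h5 := sq_nonneg (∑ t ∈ Finset.range n, (e t - m))
  have h6 : m * |∑ t ∈ Finset.range n, (t : ℝ) * (e t - m)| =
      |m * ∑ t ∈ Finset.range n, (t : ℝ) * (e t - m)| := by rw [abs_mul, abs_of_nonneg hm]
  have hgoal : B * (2 * ∑ t ∈ Finset.range n, e t + n * m) = B * S n + B * (S n + n * m) := by
    simp only [hS]
    ring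
  rw [h6, hgoal]
  obtain ⟨h1a, h1b⟩ := abs_le.1 h1
  obtain ⟨h2a, h2b⟩ := abs_le.1 h2
  have hN1 := le_abs_self (∑ t ∈ Finset.range n, x t * (x t - x (t + 1) + m))
  have hN2 := neg_abs_le (∑ t ∈ Finset.range n, x t * (x t - x (t + 1) + m))
  simp only [hS] at *
  exact abs_le.2 ⟨by linarith, by linarith⟩

/-- From `ĥ = n² N / D`, the bound `|ĥ| ≤ M` gives `|N| ≤ M D / n²`, and each of the `n` terms of
`D` is at most the squared total of the innovations. If `D = 0`, every `X ω t` with `t < n`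
vanishes, and so does `N`. -/
theorem abs_numerator_le {G : Measure ℕ} {ω : Sample} (hω : ∀ p, ω.2 p ≤ 1) {n : ℕ} (hn : 0 < n)
    {M : ℝ} (hM : 0 ≤ M) (h : ¬(olsDenom n ω ≠ 0 ∧ M < |hOLS G n ω|)) :
    |∑ t ∈ Finset.range n, (X ω t : ℝ) * ((X ω t : ℝ) - X ω (t + 1) + mean G)| ≤
      M * (∑ t ∈ Finset.range n, (ω.1 t : ℝ)) ^ 2 / n := by
  have hn' : (0 : ℝ) < n := by exact_mod_cast hn
  have hdenom : olsDenom n ω ≤ n * (∑ t ∈ Finset.range n, (ω.1 t : ℝ)) ^ 2 := by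
    unfold olsDenom
    refine (Finset.sum_le_card_nsmul _ _ ((∑ t ∈ Finset.range n, (ω.1 t : ℝ)) ^ 2)
      fun t ht => ?_).trans_eq (by simp)
    have h1 : (X ω t : ℝ) ≤ ∑ s ∈ Finset.range t, (ω.1 s : ℝ) := by exact_mod_cast X_le_sum hω t
    have h2 : ∑ s ∈ Finset.range t, (ω.1 s : ℝ) ≤ ∑ s ∈ Finset.range n, (ω.1 s : ℝ) :=
      Finset.sum_le_sum_of_subset_of_nonneg
        (Finset.range_subset_range.2 (Finset.mem_range.1 ht).le) fun _ _ _ => Nat.cast_nonneg _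
    exact pow_le_pow_left₀ (Nat.cast_nonneg _) (h1.trans h2) 2
  by_cases h0 : olsDenom n ω = 0
  · have hX : ∀ t ∈ Finset.range n, (X ω t : ℝ) = 0 := fun t ht => by
      have := (Finset.sum_eq_zero_iff_of_nonneg fun t _ => sq_nonneg (X ω t : ℝ)).1 h0 t ht
      exact pow_eq_zero_iff (two_ne_zero) |>.1 this
    rw [Finset.sum_eq_zero fun t ht => by rw [hX t ht, zero_mul], abs_zero]
    positivity
  · have hpos : 0 < olsDenom n ω :=
      lt_of_le_of_ne (Finset.sum_nonneg fun t _ => sq_nonneg _) (Ne.symm h0)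
    have hle : |hOLS G n ω| ≤ M := by
      by_contra hc
      exact h ⟨h0, not_le.1 hc⟩
    have hrep : hOLS G n ω = n ^ 2 *
        (∑ t ∈ Finset.range n, (X ω t : ℝ) * ((X ω t : ℝ) - X ω (t + 1) + mean G)) /
          olsDenom n ω := by
      have hnum : ∑ t ∈ Finset.range n, (X ω t : ℝ) * ((X ω t : ℝ) - X ω (t + 1) + mean G) =
          olsDenom n ω -
            ∑ t ∈ Finset.range n, (X ω t : ℝ) * ((X ω (t + 1) : ℝ) - mean G) := by
        rw [olsDenom, ← Finset.sum_sub_distrib]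
        exact Finset.sum_congr rfl fun t _ => by ring
      rw [hOLS, thetaOLS, hnum]
      field_simp
    rw [hrep, abs_div, abs_mul, abs_of_pos hpos, abs_of_pos (by positivity : (0 : ℝ) < (n : ℝ) ^ 2),
      div_le_iff₀ hpos] at hle
    have h2 := mul_le_mul_of_nonneg_left hdenom hM
    rw [le_div_iff₀ hn']
    refine le_of_mul_le_mul_left ?_ hn'
    linarith

/-! ### Union bound and limit -/

/-- The path bounds need indicators at most one, which the sample space of arbitrary natural numbers
ensures only almost surely. -/
theorem ae_survival_le_one (θ : I) (G : Measure ℕ) [IsProbabilityMeasure G] :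
    ∀ᵐ ω ∂(prob θ G), ∀ p, ω.2 p ≤ 1 := by
  have h : ∀ᵐ z ∂(Measure.infinitePi fun _ : ℕ × ℕ => bernoulliMeasure (1 : ℕ) 0 θ),
      ∀ p, z p ≤ 1 := by
    rw [ae_all_iff]
    intro p
    refine (measurePreserving_eval_infinitePi
      (fun _ : ℕ × ℕ => bernoulliMeasure (1 : ℕ) 0 θ) p).quasiMeasurePreserving.ae
        (p := fun k => k ≤ 1) ?_
    rw [bernoulliMeasure_def, ae_add_measure_iff]
    constructor <;> refine Measure.ae_smul_measure ?_ _ <;> simp [ae_dirac_eq]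
  exact Measure.quasiMeasurePreserving_snd.ae h

theorem measureReal_innov_event (θ : I) (G : Measure ℕ) [IsProbabilityMeasure G]
    {s : Set (ℕ → ℕ)} (hs : MeasurableSet s) :
    (prob θ G).real {ω | ω.1 ∈ s} = (innovLaw G).real s := by
  have : MeasurePreserving Prod.fst (prob θ G) (innovLaw G) := measurePreserving_fst
  exact this.measureReal_preimage hs.nullMeasurableSet

/-- Outside four events of small probability, `|ĥ| ≤ M` forces the normalised linear form in the
innovations to be bounded. -/
theorem abs_linearForm_le_of_not_large {G : Measure ℕ} {ω : Sample} (hω : ∀ p, ω.2 p ≤ 1) {n : ℕ}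
    (hn : 0 < n) {M K : ℝ} (hM : 0 ≤ M) (hK : 0 < K) (hm : 0 < mean G)
    (h : ¬(olsDenom n ω ≠ 0 ∧ M < |hOLS G n ω|))
    (h1 : ∑ t ∈ Finset.range n, (ω.1 t : ℝ) ≤ K * n) (h2 : (failures n ω : ℝ) ≤ K)
    (h3 : (∑ t ∈ Finset.range n, ((ω.1 t : ℝ) - mean G)) ^ 2 ≤ K * n)
    (h4 : ∑ t ∈ Finset.range n, ((ω.1 t : ℝ) - mean G) ^ 2 ≤ K * n) :
    |∑ t ∈ Finset.range n, (t : ℝ) / n * (ω.1 t : ℝ) -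
        ∑ t ∈ Finset.range n, (t : ℝ) / n * mean G| ≤
      (M * K ^ 2 + K * (2 * K + mean G) + K) / mean G := by
  have hn' : (0 : ℝ) < n := by exact_mod_cast hn
  have hS0 : 0 ≤ ∑ t ∈ Finset.range n, (ω.1 t : ℝ) :=
    Finset.sum_nonneg fun t _ => Nat.cast_nonneg _
  have hN := abs_numerator_le hω hn hM h
  have hN2 : M * (∑ t ∈ Finset.range n, (ω.1 t : ℝ)) ^ 2 / n ≤ M * K ^ 2 * n := by
    rw [div_le_iff₀ hn']
    have := mul_le_mul_of_nonneg_left (pow_le_pow_left₀ hS0 h1 2) hM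
    linarith
  have hlin := mul_abs_linearForm_le (x := fun t => (X ω t : ℝ)) (e := fun t => (ω.1 t : ℝ))
    (m := mean G) (B := failures n ω) (n := n) (fun t => Nat.cast_nonneg _) (by simp [X])
    (fun t => Nat.cast_nonneg _) hm.le (fun t => by exact_mod_cast X_succ_le hω t)
    (by exact_mod_cast sum_le_X_add_failures hω n)
  have hB : (failures n ω : ℝ) * (2 * ∑ t ∈ Finset.range n, (ω.1 t : ℝ) + n * mean G) ≤
      K * (2 * (K * n) + n * mean G) :=
    mul_le_mul h2 (by linarith) (by positivity) hK.le
  have hsum : ∑ t ∈ Finset.range n, (t : ℝ) / n * (ω.1 t : ℝ) -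
      ∑ t ∈ Finset.range n, (t : ℝ) / n * mean G =
      (∑ t ∈ Finset.range n, (t : ℝ) * ((ω.1 t : ℝ) - mean G)) / n := by
    rw [← Finset.sum_sub_distrib, Finset.sum_div]
    exact Finset.sum_congr rfl fun t _ => by ring
  rw [hsum, abs_div, abs_of_pos hn', le_div_iff₀ hm, div_mul_eq_mul_div, div_le_iff₀ hn']
  linarith

/-- Union bound over the four exceptional events at level `K` and the concentration event. The first
term is free of `n`, so `K` can be fixed before `n` grows. -/
theorem measureReal_not_large_le {G : Measure ℕ} [IsProbabilityMeasure G]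
    (h2 : MemLp (fun k : ℕ => (k : ℝ)) 2 G) (hm : 0 < mean G) {h : ℝ} (hh : 0 ≤ h) {n : ℕ}
    (hn : 0 < n) (hhn : h ≤ (n : ℝ) ^ 2) {M K : ℝ} (hM : 0 ≤ M) (hK : 0 < K) :
    (prob (localTheta h n) G).real {ω | ¬(olsDenom n ω ≠ 0 ∧ M < |hOLS G n ω|)} ≤
      (mean G + h * mean G + 2 * var G) / K +
      (innovLaw G).real {e | |∑ t ∈ Finset.range n, (t : ℝ) / n * (e t : ℝ) -
        ∑ t ∈ Finset.range n, (t : ℝ) / n * mean G| ≤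
          (M * K ^ 2 + K * (2 * K + mean G) + K) / mean G} := by
  have hn' : (0 : ℝ) < n := by exact_mod_cast hn
  have hint := h2.integrable (by norm_num)
  set P := prob (localTheta h n) G
  have hcoord : ∀ t : ℕ, Measurable fun e : ℕ → ℕ => (e t : ℝ) := fun t =>
    measurable_from_nat.comp (measurable_pi_apply t)
  set E₁ : Set (ℕ → ℕ) := {e | K * n < ∑ t ∈ Finset.range n, (e t : ℝ)}
  set E₂ : Set (ℕ → ℕ) := {e | K * n < (∑ t ∈ Finset.range n, ((e t : ℝ) - mean G)) ^ 2}
  set E₃ : Set (ℕ → ℕ) := {e | K * n < ∑ t ∈ Finset.range n, ((e t : ℝ) - mean G) ^ 2}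
  set E₄ : Set (ℕ → ℕ) := {e | |∑ t ∈ Finset.range n, (t : ℝ) / n * (e t : ℝ) -
        ∑ t ∈ Finset.range n, (t : ℝ) / n * mean G| ≤
          (M * K ^ 2 + K * (2 * K + mean G) + K) / mean G}
  set F : Set Sample := {ω | K < (failures n ω : ℝ)}
  have m₁ : MeasurableSet E₁ := measurableSet_lt (by fun_prop) (by fun_prop)
  have m₂ : MeasurableSet E₂ := measurableSet_lt (by fun_prop) (by fun_prop)
  have m₃ : MeasurableSet E₃ := measurableSet_lt (by fun_prop) (by fun_prop)
  have m₄ : MeasurableSet E₄ := measurableSet_le (by fun_prop) (by fun_prop)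
  have b₁ : P.real {ω | ω.1 ∈ E₁} ≤ mean G / K := by
    rw [measureReal_innov_event _ _ m₁]
    exact measureReal_sum_innov_gt hint hn hK
  have b₂ : P.real {ω | ω.1 ∈ E₂} ≤ var G / K := by
    rw [measureReal_innov_event _ _ m₂]
    exact measureReal_sq_sum_centered_gt h2 hn hK
  have b₃ : P.real {ω | ω.1 ∈ E₃} ≤ var G / K := by
    rw [measureReal_innov_event _ _ m₃]
    exact measureReal_sum_centered_sq_gt h2 hn hK
  have b₄ : P.real {ω | ω.1 ∈ E₄} = (innovLaw G).real E₄ := measureReal_innov_event _ _ m₄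
  have bF : P.real F ≤ h * mean G / K := by
    refine measureReal_failures_gt _ hint hK (le_of_eq ?_)
    rw [coe_localTheta hh hhn]
    field_simp
    ring
  have hsub : P.real {ω | ¬(olsDenom n ω ≠ 0 ∧ M < |hOLS G n ω|)} ≤
      P.real ({ω | ω.1 ∈ E₁} ∪ F ∪ {ω | ω.1 ∈ E₂} ∪ {ω | ω.1 ∈ E₃} ∪ {ω | ω.1 ∈ E₄}) := by
    refine ENNReal.toReal_mono (measure_ne_top _ _) (measure_mono_ae ?_)
    filter_upwards [ae_survival_le_one (localTheta h n) G] with ω hω hbad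
    by_contra hc
    have c₁ : ω.1 ∉ E₁ := fun hx => hc (Or.inl (Or.inl (Or.inl (Or.inl hx))))
    have cF : ω ∉ F := fun hx => hc (Or.inl (Or.inl (Or.inl (Or.inr hx))))
    have c₂ : ω.1 ∉ E₂ := fun hx => hc (Or.inl (Or.inl (Or.inr hx)))
    have c₃ : ω.1 ∉ E₃ := fun hx => hc (Or.inl (Or.inr hx))
    have c₄ : ω.1 ∉ E₄ := fun hx => hc (Or.inr hx)
    exact c₄ (abs_linearForm_le_of_not_large hω hn hM hK hm hbad (not_lt.1 c₁) (not_lt.1 cF)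
      (not_lt.1 c₂) (not_lt.1 c₃))
  have u1 := measureReal_union_le (μ := P)
    ({ω | ω.1 ∈ E₁} ∪ F ∪ {ω | ω.1 ∈ E₂} ∪ {ω | ω.1 ∈ E₃}) {ω | ω.1 ∈ E₄}
  have u2 := measureReal_union_le (μ := P)
    ({ω | ω.1 ∈ E₁} ∪ F ∪ {ω | ω.1 ∈ E₂}) {ω | ω.1 ∈ E₃}
  have u3 := measureReal_union_le (μ := P) ({ω | ω.1 ∈ E₁} ∪ F) {ω | ω.1 ∈ E₂}
  have u4 := measureReal_union_le (μ := P) {ω | ω.1 ∈ E₁} F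
  have hsplit : (mean G + h * mean G + 2 * var G) / K =
      mean G / K + h * mean G / K + var G / K + var G / K := by ring
  rw [hsplit]
  linarith

theorem tendsto_measureReal_not_large {G : Measure ℕ} [IsProbabilityMeasure G]
    (hG : ∀ m : ℕ, G ≠ Measure.dirac m) (h2 : MemLp (fun k : ℕ => (k : ℝ)) 2 G)
    {h : ℝ} (hh : 0 ≤ h) {M : ℝ} (hM : 0 ≤ M) :
    Tendsto (fun n : ℕ => (prob (localTheta h n) G).real
      {ω | ¬(olsDenom n ω ≠ 0 ∧ M < |hOLS G n ω|)}) atTop (𝓝 0) := by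
  have hm : 0 < mean G := mean_pos hG (h2.integrable (by norm_num))
  have hv : 0 ≤ var G := integral_nonneg fun k => sq_nonneg _
  refine Metric.tendsto_atTop'.2 fun ε hε => ?_
  set a := mean G + h * mean G + 2 * var G
  have ha : 0 < a := by positivity
  -- This choice makes the exceptional events cost `ε / 2`; anti-concentration at the resulting
  -- fixed scale supplies the other half.
  set K := 2 * a / ε
  have hK : 0 < K := by positivity
  have haK : a / K = ε / 2 := by
    simp only [K]
    field_simp
  have hconc := tendsto_measureReal_weightedSum hG
    (fun n => ∑ t ∈ Finset.range n, (t : ℝ) / n * mean G)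
    (C := (M * K ^ 2 + K * (2 * K + mean G) + K) / mean G) (by positivity)
  have hev : ∀ᶠ n : ℕ in atTop, h ≤ (n : ℝ) ^ 2 :=
    ((tendsto_pow_atTop two_ne_zero).comp tendsto_natCast_atTop_atTop).eventually_ge_atTop h
  obtain ⟨N, hN⟩ := eventually_atTop.1
    ((hconc.eventually_lt_const (half_pos hε)).and (hev.and (eventually_gt_atTop 0)))
  refine ⟨N, fun n hn => ?_⟩
  obtain ⟨hlt, hhn, hn0⟩ := hN n hn.le
  have := measureReal_not_large_le h2 hm hh hn0 hhn hM hK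
  rw [Real.dist_eq, sub_zero, abs_of_nonneg measureReal_nonneg]
  linarith

end INAR

end

theorem proposition4p3 (G : Measure ℕ) [IsProbabilityMeasure G]
    (hG : ∀ m : ℕ, G ≠ Measure.dirac m)
    (hG3 : Integrable (fun k : ℕ => (k : ℝ) ^ 3) G)
    (h : ℝ) (hh : 0 ≤ h) (M : ℝ) :
    Tendsto
      (fun n : ℕ => INAR.prob (INAR.localTheta h n) G
        {ω | INAR.olsDenom n ω ≠ 0 ∧ M < |INAR.hOLS G n ω|})
      atTop (𝓝 1) := by
  -- The estimates need a nonnegative threshold; raising `M` to `max M 0` only shrinks the event.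
  have hbad := INAR.tendsto_measureReal_not_large hG (INAR.memLp_two_of_cube hG3) hh
    (le_max_right M 0)
  have hlow : Tendsto (fun n : ℕ => 1 - ENNReal.ofReal ((INAR.prob (INAR.localTheta h n) G).real
      {ω | ¬(INAR.olsDenom n ω ≠ 0 ∧ max M 0 < |INAR.hOLS G n ω|)})) atTop (𝓝 1) := by
    have h1 := ENNReal.tendsto_ofReal hbad
    have h2 := ENNReal.Tendsto.sub (tendsto_const_nhds (x := (1 : ENNReal))) h1
      (Or.inl ENNReal.one_ne_top)
    simpa using h2
  refine tendsto_of_tendsto_of_tendsto_of_le_of_le hlow tendsto_const_nhds (fun n => ?_)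
    fun n => prob_le_one
  -- Covering the whole space by the event and the bad set uses only subadditivity, so no
  -- measurability of the event is needed.
  rw [ofReal_measureReal, tsub_le_iff_right, ← measure_univ (μ := INAR.prob (INAR.localTheta h n) G)]
  refine (measure_mono fun ω _ => ?_).trans (measure_union_le _ _)
  by_cases hω : INAR.olsDenom n ω ≠ 0 ∧ max M 0 < |INAR.hOLS G n ω|
  · exact Or.inl ⟨hω.1, (le_max_left M 0).trans_lt hω.2⟩
  · exact Or.inr hω
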